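/- Let $G$ be a planar triangulation, that is, a finite connected simple graph embedded in the plane (equivalently, the sphere) such that every face, including the outer face, is bounded by a triangle. Let $T(G)$ be the Kleetope of $G$: the graph obtained from $G$ by adding, in each face of $G$, a new vertex adjacent to every vertex on that face. A set $D$ of vertices of a graph is total dominating if every vertex of the graph has a neighbour in $D$, and $\mathrm{td}(H)$ denotes the maximum number of colours in a (not necessarily proper) vertex colouring of $H$ in which every colour class is a total dominating set of $H$ (equivalently, the maximum number of pairwise disjoint total dominating sets of $H$). Then $\mathrm{td}(T(G))\ge 2$; that is, $T(G)$ has two disjoint total dominating sets. -/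

import Mathlib

namespace SimpleGraph

/-- `D` is a total dominating set of `G`: every vertex of `G` has a neighbour in `D`. -/
def IsTotalDominating {V : Type*} (G : SimpleGraph V) (D : Set V) : Prop :=
  ∀ v : V, ∃ w ∈ D, G.Adj v w

/-- The total domatic number `td(G)`: the maximum number `k` of colours in a (not necessarily
proper) colouring of the vertices in which every colour appears in every open neighbourhood,
that is, in which every colour class is a total dominating set.
(For a finite nonempty graph such numbers `k` are at most the number of vertices.) -/
noncomputable def totalDomaticNumber {V : Type*} (G : SimpleGraph V) : ℕ :=
  sSup {k : ℕ | ∃ C : V → Fin k, ∀ i : Fin k, G.IsTotalDominating (C ⁻¹' {i})}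

/-- A rotation system on `G`: for every vertex, a cyclic order of the darts (directed edges)
leaving it.  On a finite connected graph this is the combinatorial form of a 2-cell embedding
of `G` in a closed oriented surface. -/
structure RotationSystem {V : Type*} (G : SimpleGraph V) where
  /-- The next dart around the initial vertex of a dart. -/
  rot : Equiv.Perm G.Dart
  /-- The rotation keeps the initial vertex. -/
  fst_rot : ∀ d : G.Dart, (rot d).fst = d.fst
  /-- All darts leaving one vertex form a single cycle of the rotation. -/
  sameCycle_rot : ∀ d d' : G.Dart, d.fst = d'.fst → rot.SameCycle d d'

namespace RotationSystem

/-- Face tracing: the dart `u → v` is followed by the dart leaving `v` that comes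
next after `v → u` in the rotation at `v`. -/
def facePerm {V : Type*} {G : SimpleGraph V} (R : G.RotationSystem) : Equiv.Perm G.Dart :=
  (Function.Involutive.toPerm Dart.symm Dart.symm_involutive).trans R.rot

/-- The faces of the embedded graph: the orbits of face tracing on the darts. -/
def Face {V : Type*} {G : SimpleGraph V} (R : G.RotationSystem) : Type _ :=
  Quotient (Equiv.Perm.SameCycle.setoid R.facePerm)

/-- The face whose boundary walk traverses the dart `d`. -/
def faceOf {V : Type*} {G : SimpleGraph V} (R : G.RotationSystem) (d : G.Dart) : R.Face :=
  Quotient.mk (Equiv.Perm.SameCycle.setoid R.facePerm) d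

/-- The vertex `v` lies on (the boundary of) the face `f`. -/
def OnFace {V : Type*} {G : SimpleGraph V} (R : G.RotationSystem) (v : V) (f : R.Face) : Prop :=
  ∃ d : G.Dart, R.faceOf d = f ∧ d.fst = v

/-- The length of the boundary walk of the face `f`. -/
noncomputable def faceLength {V : Type*} {G : SimpleGraph V} (R : G.RotationSystem)
    (f : R.Face) : ℕ :=
  {d : G.Dart | R.faceOf d = f}.ncard

/-- The embedding of a finite graph with at least one edge is a 2-cell embedding in the sphere:
the graph is connected and Euler's formula `|V| - |E| + |F| = 2` holds. -/
def IsPlanar {V : Type*} {G : SimpleGraph V} (R : G.RotationSystem) : Prop :=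
  G.Connected ∧
    (Nat.card V : ℤ) - (Nat.card G.edgeSet : ℤ) + (Nat.card R.Face : ℤ) = 2

/-- A planar triangulation: a connected simple graph embedded in the sphere such that every face
(the outer one included) is bounded by a triangle.  As `G` has no loops and no multiple edges, a
boundary walk of length three is a triangle. -/
def IsPlanarTriangulation {V : Type*} {G : SimpleGraph V} (R : G.RotationSystem) : Prop :=
  R.IsPlanar ∧ ∀ f : R.Face, R.faceLength f = 3

/-- Adjacency in `T(G)`: the adjacency of `G` on old vertices; the new vertex of a
face is adjacent exactly to the vertices on that face. -/
def kleetopeAdj {V : Type*} {G : SimpleGraph V} (R : G.RotationSystem) :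
    V ⊕ R.Face → V ⊕ R.Face → Prop
  | Sum.inl u, Sum.inl v => G.Adj u v
  | Sum.inl v, Sum.inr f => R.OnFace v f
  | Sum.inr f, Sum.inl v => R.OnFace v f
  | Sum.inr _, Sum.inr _ => False

/-- The Kleetope `T(G)` of the embedded graph `G`: add in each face of `G` a new vertex that is
adjacent to every vertex on that face. -/
def kleetope {V : Type*} {G : SimpleGraph V} (R : G.RotationSystem) :
    SimpleGraph (V ⊕ R.Face) where
  Adj := R.kleetopeAdj
  symm := ⟨by
    rintro (u | f) (v | g) h
    · exact SimpleGraph.Adj.symm h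
    · exact h
    · exact h
    · exact h⟩
  loopless := ⟨by
    rintro (u | f) h
    · exact G.irrefl h
    · exact h⟩

end RotationSystem

end SimpleGraph

namespace SimpleGraph

namespace RotationSystem

open Finset

/-! ### Face tracing -/

variable {V : Type*} {G : SimpleGraph V} (R : G.RotationSystem)

/-! The dual of a triangulation, taken with multiplicities, is cubic and bridgeless, so Petersen's
argument gives it a perfect matching: a set of edges of `G`, exactly one on each face
(`exists_edgeSet_existsUnique_dart`). The remaining edges meet every face twice, hence form a cut,
because the sphere has no first homology modulo 2 (`exists_eq_add_of_sum_face_eq_zero`). The sides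
of the cut colour `V` without monochromatic faces. So each new vertex sees both colours and each old
vertex sees the opposite one. An old vertex may lack a neighbour of its own colour, but no face has
two such vertices; the new vertex of a face takes the colour of that one, if any. -/

lemma faceOf_facePerm (d : G.Dart) : R.faceOf (R.facePerm d) = R.faceOf d :=
  Quotient.sound (Equiv.Perm.sameCycle_apply_left.2 (Equiv.Perm.SameCycle.refl _ _))

lemma faceOf_eq_iff {d e : G.Dart} : R.faceOf d = R.faceOf e ↔ R.facePerm.SameCycle d e :=
  ⟨fun h => Quotient.exact h, fun h => Quotient.sound h⟩

lemma faceOf_surjective : Function.Surjective R.faceOf := Quotient.mk_surjective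

lemma fst_facePerm (d : G.Dart) : (R.facePerm d).fst = d.snd := R.fst_rot d.symm

lemma rot_eq_facePerm_symm (d : G.Dart) : R.rot d = R.facePerm d.symm := by
  simp [facePerm]

lemma onFace_fst (d : G.Dart) : R.OnFace d.fst (R.faceOf d) := ⟨d, rfl, rfl⟩

lemma onFace_snd (d : G.Dart) : R.OnFace d.snd (R.faceOf d) :=
  ⟨R.facePerm d, R.faceOf_facePerm d, R.fst_facePerm d⟩

/-- A function on faces that takes equal values on the two sides of every edge is constant. -/
lemma eq_of_forall_faceOf_symm (hG : G.Connected) {α : Type*} {y : R.Face → α}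
    (hy : ∀ d, y (R.faceOf d) = y (R.faceOf d.symm)) (f g : R.Face) : y f = y g := by
  have hrot (d : G.Dart) : y (R.faceOf (R.rot d)) = y (R.faceOf d) := by
    rw [rot_eq_facePerm_symm, faceOf_facePerm, ← hy]
  have hcyc (d e : G.Dart) (h : d.fst = e.fst) : y (R.faceOf d) = y (R.faceOf e) := by
    obtain ⟨n, rfl⟩ := R.sameCycle_rot d e h
    have hz : ∀ n : ℤ, y (R.faceOf ((R.rot ^ n) d)) = y (R.faceOf d) := by
      intro n
      induction n using Int.induction_on with
      | zero => simp
      | succ n ih => rw [add_comm, zpow_add, zpow_one, Equiv.Perm.mul_apply, hrot, ih]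
      | pred n ih =>
        rw [← ih, ← hrot, ← Equiv.Perm.mul_apply, ← zpow_one_add]
        congr 4
        ring
    exact (hz n).symm
  obtain ⟨d, rfl⟩ := R.faceOf_surjective f
  obtain ⟨e, rfl⟩ := R.faceOf_surjective g
  have key : ∀ u v (p : G.Walk u v) (d e : G.Dart), d.fst = u → e.fst = v →
      y (R.faceOf d) = y (R.faceOf e) := by
    intro u v p
    induction p with
    | nil => exact fun d e hd he => hcyc d e (hd.trans he.symm)
    | cons h p ih =>
      intro d e hd he
      let a : G.Dart := ⟨(_, _), h⟩
      rw [hcyc d a hd, hy a]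
      exact ih a.symm e rfl he
  obtain ⟨p⟩ := hG.preconnected d.fst e.fst
  exact key _ _ p d e rfl rfl

/-! ### Counting darts on the boundary of a set of faces -/

section Sums

variable [Fintype G.Dart] [DecidableEq R.Face]

lemma sum_face_snd {M : Type*} [AddCommMonoid M] (x : V → M) (f : R.Face) :
    ∑ d with R.faceOf d = f, x d.snd = ∑ d with R.faceOf d = f, x d.fst := by
  refine Finset.sum_equiv R.facePerm (fun d => ?_) (fun d _ => ?_)
  · simp [faceOf_facePerm]
  · rw [fst_facePerm]

lemma card_face (h3 : ∀ f, R.faceLength f = 3) (f : R.Face) :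
    #{d | R.faceOf d = f} = 3 := by
  rw [← h3 f, faceLength, ← Set.ncard_coe_finset]
  simp

lemma card_filter_faceOf_mem (h3 : ∀ f, R.faceLength f = 3) (S : Finset R.Face) :
    #{d | R.faceOf d ∈ S} = 3 * #S := by
  rw [Finset.card_eq_sum_card_fiberwise (f := R.faceOf) (t := S) (fun d hd => by simpa using hd),
    Finset.sum_congr rfl (g := fun _ => 3), sum_const, smul_eq_mul, mul_comm]
  intro f hf
  rw [← R.card_face h3 f, filter_filter]
  congr 1
  ext d
  simp only [mem_filter, mem_univ, true_and]
  exact ⟨fun h => h.2, fun h => ⟨h ▸ hf, h⟩⟩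

/-- The darts that lead, through their edge, from a face in `S` to a face outside `S`. -/
def boundary (S : Finset R.Face) : Finset G.Dart :=
  {d | R.faceOf d ∈ S ∧ R.faceOf d.symm ∉ S}

lemma sum_boundary_add_sum_inner {M : Type*} [AddCommMonoid M] (S : Finset R.Face)
    (g : G.Dart → M) :
    ∑ d ∈ R.boundary S, g d + ∑ d with R.faceOf d ∈ S ∧ R.faceOf d.symm ∈ S, g d =
      ∑ d with R.faceOf d ∈ S, g d := by
  rw [← Finset.sum_filter_not_add_sum_filter {d | R.faceOf d ∈ S}
    (fun d : G.Dart => R.faceOf d.symm ∈ S), filter_filter, filter_filter, boundary]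

/-- Modulo 2, inner darts cancel in pairs under reversal, leaving the total `3 * #S`. -/
lemma odd_card_boundary (h3 : ∀ f, R.faceLength f = 3) {S : Finset R.Face} (hS : Odd #S) :
    Odd #(R.boundary S) := by
  have h := R.sum_boundary_add_sum_inner S (fun _ => (1 : ZMod 2))
  have h0 : ∑ d with R.faceOf d ∈ S ∧ R.faceOf d.symm ∈ S, (1 : ZMod 2) = 0 := by
    refine Finset.sum_involution (fun d _ => d.symm) (fun _ _ => by decide)
      (fun d _ _ => d.symm_ne) (fun d hd => ?_) (fun d _ => d.symm_symm)
    simpa [and_comm] using hd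
  rw [h0, add_zero] at h
  simp only [sum_const, nsmul_eq_mul, mul_one, R.card_filter_faceOf_mem h3] at h
  rw [← ZMod.natCast_eq_one_iff_odd] at hS ⊢
  rw [h, Nat.cast_mul, hS]
  decide

/-- The dual graph has no bridges. -/
lemma card_boundary_ne_one (S : Finset R.Face) : #(R.boundary S) ≠ 1 := by
  classical
  intro h
  obtain ⟨a, ha⟩ := Finset.card_eq_one.1 h
  -- The differences of `x` along darts telescope around each face and cancel on inner edges, so
  -- they sum to zero over the boundary. A lone boundary dart `a` would contribute 1.
  let x : V → ℤ := fun v => if v = a.fst then 1 else 0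
  have h1 := R.sum_boundary_add_sum_inner S (fun d => x d.fst - x d.snd)
  have h2 : ∑ d with R.faceOf d ∈ S, (x d.fst - x d.snd) = 0 := by
    rw [← Finset.sum_fiberwise_of_maps_to (g := R.faceOf) (t := S) (fun d hd => by simpa using hd)]
    refine Finset.sum_eq_zero fun f hf => ?_
    have : ({d ∈ ({d | R.faceOf d ∈ S} : Finset G.Dart) | R.faceOf d = f}) =
        ({d | R.faceOf d = f} : Finset G.Dart) := by
      ext d
      simp only [mem_filter, mem_univ, true_and]
      exact ⟨fun h => h.2, fun h => ⟨h ▸ hf, h⟩⟩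
    rw [this, sum_sub_distrib, sum_face_snd, sub_self]
  have h3 : ∑ d with R.faceOf d ∈ S ∧ R.faceOf d.symm ∈ S, (x d.fst - x d.snd) = 0 := by
    refine Finset.sum_involution (fun d _ => d.symm) (fun d _ => ?_)
      (fun d _ _ => d.symm_ne) (fun d hd => ?_) (fun d _ => d.symm_symm)
    · change x d.fst - x d.snd + (x d.snd - x d.fst) = 0
      ring
    · simpa [and_comm] using hd
  rw [h2, h3, ha, sum_singleton, add_zero] at h1
  simp [x, a.snd_ne_fst] at h1

end Sums

/-! ### Perfect matching in the dual -/

/-- The dual graph of the embedded graph, without loops and multiple edges. -/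
def dualGraph : SimpleGraph R.Face :=
  SimpleGraph.fromRel fun f g => ∃ d, R.faceOf d = f ∧ R.faceOf d.symm = g

lemma dualGraph_adj {f g : R.Face} :
    R.dualGraph.Adj f g ↔ f ≠ g ∧ ∃ d, R.faceOf d = f ∧ R.faceOf d.symm = g := by
  rw [dualGraph, fromRel_adj, and_congr_right_iff]
  refine fun _ => ⟨?_, Or.inl⟩
  rintro (h | ⟨d, h, h'⟩)
  · exact h
  · exact ⟨d.symm, h', by rwa [Dart.symm_symm]⟩

instance [Finite V] : Finite G.Dart :=
  Finite.of_injective _ (Dart.toProd_injective (G := G))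

instance [Finite V] : Finite R.Face := Finite.of_surjective _ R.faceOf_surjective

/-- Each odd component sends an odd number of edges to `U`, and not just one, hence at least three.
The faces in `U` can receive only three each. -/
lemma not_isTutteViolator_dualGraph [Finite V] (h3 : ∀ f, R.faceLength f = 3) (U : Set R.Face) :
    ¬ R.dualGraph.IsTutteViolator U := by
  classical
  have := Fintype.ofFinite R.Face
  have := Fintype.ofFinite G.Dart
  rw [IsTutteViolator, not_lt]
  set H := ((⊤ : R.dualGraph.Subgraph).deleteVerts U).coe with hH
  have := Fintype.ofFinite H.ConnectedComponent
  let S (C : H.ConnectedComponent) : Finset R.Face := {f | ∃ h, (⟨f, h⟩ : _) ∈ C.supp}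
  have hSU (C) (f) (hf : f ∈ S C) : f ∉ U := by
    obtain ⟨h, -⟩ := (mem_filter.1 hf).2
    simpa using h
  have hcard (C : H.ConnectedComponent) : #(S C) = C.supp.ncard := by
    rw [← Set.ncard_coe_finset, ← Set.ncard_image_of_injective C.supp Subtype.val_injective]
    congr 1
    ext f
    simp [S]
  have hclosed (C) (d : G.Dart) (hd : d ∈ R.boundary (S C)) : R.faceOf d.symm ∈ U := by
    obtain ⟨h1, h2⟩ := (mem_filter.1 hd).2
    by_contra hU
    apply h2
    have hne : R.faceOf d ≠ R.faceOf d.symm := fun h => h2 (h ▸ h1)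
    have hdU := hSU C _ h1
    obtain ⟨h, hC⟩ := (mem_filter.1 h1).2
    refine mem_filter.2 ⟨mem_univ _, by simpa using hU, ?_⟩
    refine C.mem_supp_of_adj_mem_supp hC ?_
    simp only [hH, Subgraph.coe_adj, Subgraph.deleteVerts_adj, Subgraph.verts_top, Set.mem_univ,
      true_and, Subgraph.top_adj]
    exact ⟨hdU, hU, R.dualGraph_adj.2 ⟨hne, d, rfl, rfl⟩⟩
  have hdisj (C C' : H.ConnectedComponent) (hne : C ≠ C') :
      Disjoint (R.boundary (S C)) (R.boundary (S C')) := by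
    rw [Finset.disjoint_left]
    intro d hd hd'
    obtain ⟨h, hC⟩ := (mem_filter.1 (mem_filter.1 hd).2.1).2
    obtain ⟨h', hC'⟩ := (mem_filter.1 (mem_filter.1 hd').2.1).2
    exact hne (ConnectedComponent.eq_of_common_vertex hC hC')
  let O : Finset H.ConnectedComponent := {C | Odd C.supp.ncard}
  have hO : H.oddComponents.ncard = #O := by
    rw [← Set.ncard_coe_finset]
    simp [O, oddComponents]
  have hU : U.ncard = #U.toFinset := Set.ncard_eq_toFinset_card' U
  rw [hO, hU]
  suffices 3 * #O ≤ 3 * #U.toFinset by omega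
  calc 3 * #O = ∑ C ∈ O, 3 := by rw [sum_const, smul_eq_mul, mul_comm]
    _ ≤ ∑ C ∈ O, #(R.boundary (S C)) := by
      refine sum_le_sum fun C hC => ?_
      have h1 : Odd #(S C) := by
        rw [hcard]
        exact (mem_filter.1 hC).2
      have h2 := R.odd_card_boundary h3 h1
      have h3 := R.card_boundary_ne_one (S C)
      obtain ⟨k, hk⟩ := h2
      omega
    _ = #(O.biUnion fun C => R.boundary (S C)) :=
      (card_biUnion fun C _ C' _ h => hdisj C C' h).symm
    _ ≤ #({d | R.faceOf d ∈ U.toFinset} : Finset G.Dart) := by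
      refine Finset.card_le_card_of_injOn Dart.symm (fun d hd => ?_)
        Dart.symm_involutive.injective.injOn
      obtain ⟨C, -, hd⟩ := mem_biUnion.1 hd
      simpa using hclosed C d hd
    _ = 3 * #U.toFinset := R.card_filter_faceOf_mem h3 _

/-- **Petersen's theorem** for the dual of a triangulation: there is a set of edges of `G` of which
every face has exactly one on its boundary. -/
lemma exists_edgeSet_existsUnique_dart [Finite V] (h3 : ∀ f, R.faceLength f = 3) :
    ∃ m : Set (Sym2 V), ∀ f, ∃! d, R.faceOf d = f ∧ d.edge ∈ m := by
  classical
  obtain ⟨M, hM⟩ := tutte.2 (R.not_isTutteViolator_dualGraph h3)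
  rw [Subgraph.isPerfectMatching_iff] at hM
  have hex (e : M.edgeSet) : ∃ d : G.Dart, s(R.faceOf d, R.faceOf d.symm) = e := by
    obtain ⟨⟨f, g⟩, he⟩ := e
    obtain ⟨-, d, rfl, rfl⟩ := R.dualGraph_adj.1 (M.adj_sub he)
    exact ⟨d, rfl⟩
  -- Two faces may share several edges; only one of them is selected for each matched pair.
  choose D hD using hex
  refine ⟨Set.range fun e => (D e).edge, fun f => ?_⟩
  obtain ⟨g, hfg, hg⟩ := hM f
  have hne : f ≠ g := (M.adj_sub hfg).ne
  have hside (d : G.Dart) (h : (D ⟨s(f, g), hfg⟩).edge = d.edge) :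
      s(R.faceOf d, R.faceOf d.symm) = s(f, g) := by
    have h1 := hD ⟨s(f, g), hfg⟩
    rcases (dart_edge_eq_iff _ _).1 h with h | h
    · rwa [h] at h1
    · rw [h, Dart.symm_symm, Sym2.eq_swap] at h1
      exact h1
  have huniq (d e : G.Dart) (hd : R.faceOf d = f) (he : R.faceOf e = f)
      (hd' : (D ⟨s(f, g), hfg⟩).edge = d.edge) (he' : (D ⟨s(f, g), hfg⟩).edge = e.edge) :
      d = e := by
    rcases (dart_edge_eq_iff _ _).1 (hd'.symm.trans he') with h | h
    · exact h
    · have := hside d hd'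
      rw [hd, h, Dart.symm_symm, he] at this
      simp [hne] at this
  have hform (d : G.Dart) (hd : R.faceOf d = f) (h : d.edge ∈ Set.range fun e => (D e).edge) :
      (D ⟨s(f, g), hfg⟩).edge = d.edge := by
    obtain ⟨⟨e, he⟩, h⟩ := h
    have h1 := hD ⟨e, he⟩
    have hfe : f ∈ e := by
      rcases (dart_edge_eq_iff _ _).1 h with h | h
      · rw [h, hd] at h1
        exact (show s(f, _) = e from h1) ▸ Sym2.mem_mk_left _ _
      · rw [h, Dart.symm_symm, hd] at h1
        exact (show s(_, f) = e from h1) ▸ Sym2.mem_mk_right _ _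
    obtain ⟨g', rfl⟩ := hfe
    obtain rfl := hg g' he
    exact h
  have h1 := hD ⟨s(f, g), hfg⟩
  rcases Sym2.eq_iff.1 h1 with ⟨h1, h2⟩ | ⟨h1, h2⟩
  · exact ⟨D ⟨s(f, g), hfg⟩, ⟨h1, ⟨_, rfl⟩⟩,
      fun d hd => huniq _ _ hd.1 h1 (hform d hd.1 hd.2) rfl⟩
  · exact ⟨(D ⟨s(f, g), hfg⟩).symm, ⟨h2, ⟨_, (Dart.edge_symm _).symm⟩⟩,
      fun d hd => huniq _ _ hd.1 h2 (hform d hd.1 hd.2) (Dart.edge_symm _).symm⟩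

/-! ### Cuts and homology modulo 2 -/

section Homology

variable [Fintype G.Dart]

lemma sum_dart_edge [DecidableEq V] {M : Type*} [AddCommMonoid M] (g : G.Dart → M) (d : G.Dart) :
    ∑ e with e.edge = d.edge, g e = g d + g d.symm := by
  have : ({e | e.edge = d.edge} : Finset G.Dart) = {d, d.symm} := by
    ext e
    simp [dart_edge_eq_iff]
  rw [this, sum_pair d.symm_ne.symm]

open scoped Classical in
/-- The vertex-edge incidence matrix modulo 2. -/
noncomputable def edgeVertexMatrix (G : SimpleGraph V) [Fintype G.Dart] :
    Matrix G.edgeSet V (ZMod 2) :=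
  fun e v => ∑ d : G.Dart, if d.edge = e ∧ d.fst = v then 1 else 0

open scoped Classical in
/-- The face-edge incidence matrix modulo 2. -/
noncomputable def faceEdgeMatrix : Matrix R.Face G.edgeSet (ZMod 2) :=
  fun f e => ∑ d : G.Dart, if R.faceOf d = f ∧ d.edge = e then 1 else 0

lemma edgeVertexMatrix_mulVec [Fintype V] (x : V → ZMod 2) (d : G.Dart) :
    (edgeVertexMatrix G).mulVec x ⟨d.edge, d.edge_mem⟩ = x d.fst + x d.snd := by
  classical
  have : x d.fst + x d.snd = x d.fst + x d.symm.fst := rfl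
  rw [this, ← sum_dart_edge (fun d => x d.fst) d]
  simp only [Matrix.mulVec, dotProduct, edgeVertexMatrix, sum_mul]
  rw [sum_comm, sum_filter]
  refine sum_congr rfl fun e _ => ?_
  by_cases h : e.edge = d.edge <;> simp [h]

lemma faceEdgeMatrix_mulVec [Fintype G.edgeSet] [DecidableEq R.Face] (c : G.edgeSet → ZMod 2)
    (f : R.Face) :
    R.faceEdgeMatrix.mulVec c f = ∑ d with R.faceOf d = f, c ⟨d.edge, d.edge_mem⟩ := by
  classical
  simp only [Matrix.mulVec, dotProduct, faceEdgeMatrix, sum_mul]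
  rw [sum_comm, sum_filter]
  refine sum_congr rfl fun d _ => ?_
  by_cases h : R.faceOf d = f
  · simp only [h, true_and, ite_mul, one_mul, zero_mul, if_true]
    rw [sum_eq_single ⟨d.edge, d.edge_mem⟩] <;> simp +contextual [Subtype.ext_iff, eq_comm]
  · simp [h]

lemma faceEdgeMatrix_transpose_mulVec [Fintype R.Face] (y : R.Face → ZMod 2) (d : G.Dart) :
    R.faceEdgeMatrix.transpose.mulVec y ⟨d.edge, d.edge_mem⟩ =
      y (R.faceOf d) + y (R.faceOf d.symm) := by
  classical
  rw [← sum_dart_edge (fun d => y (R.faceOf d)) d]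
  simp only [Matrix.mulVec, dotProduct, faceEdgeMatrix, Matrix.transpose_apply, sum_mul]
  rw [sum_comm, sum_filter]
  refine sum_congr rfl fun e _ => ?_
  by_cases h : e.edge = d.edge <;> simp [h]

end Homology

/-- If the kernel of a matrix consists of constant vectors, its rank is the number of columns or
one less. -/
lemma card_le_rank_add_one {m n K : Type*} [Field K] [Fintype m] [Fintype n] (A : Matrix m n K)
    (hA : ∀ x, A.mulVec x = 0 → ∀ i j, x i = x j) : Fintype.card n ≤ A.rank + 1 := by
  have h1 := A.mulVecLin.finrank_range_add_finrank_ker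
  rw [Module.finrank_fintype_fun_eq_card] at h1
  have h2 : Module.finrank K (LinearMap.ker A.mulVecLin) ≤ 1 := by
    have hle : LinearMap.ker A.mulVecLin ≤ Submodule.span K {fun _ => (1 : K)} := by
      intro x hx
      have hx' := hA x hx
      rw [Submodule.mem_span_singleton]
      rcases isEmpty_or_nonempty n with h | ⟨⟨i⟩⟩
      · exact ⟨0, Subsingleton.elim _ _⟩
      · exact ⟨x i, by ext j; simp [hx' i j]⟩
    exact (Submodule.finrank_mono hle).trans ((finrank_span_le_card _).trans (by simp))
  rw [Matrix.rank]
  omega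

/-- On the sphere, a set of edges that meets every face boundary evenly is a cut. -/
lemma exists_eq_add_of_sum_face_eq_zero [Finite V] [Fintype G.Dart] [DecidableEq R.Face]
    (hR : R.IsPlanar) (c : Sym2 V → ZMod 2)
    (hc : ∀ f, ∑ d with R.faceOf d = f, c d.edge = 0) :
    ∃ x : V → ZMod 2, ∀ d : G.Dart, x d.fst + x d.snd = c d.edge := by
  classical
  have := Fintype.ofFinite V
  have := Fintype.ofFinite R.Face
  have := Fintype.ofFinite G.edgeSet
  obtain ⟨hG, hE⟩ := hR
  have zero_of_add {a b : ZMod 2} (h : a + b = 0) : a = b := by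
    revert a b
    decide
  set A := edgeVertexMatrix G
  set B := R.faceEdgeMatrix
  have hA : Fintype.card V ≤ A.rank + 1 := by
    refine card_le_rank_add_one A fun x hx u v => ?_
    obtain ⟨p⟩ := hG.preconnected u v
    induction p with
    | nil => rfl
    | @cons u w _ h p ih =>
      rw [← ih]
      have := edgeVertexMatrix_mulVec x (⟨(u, w), h⟩ : G.Dart)
      change A.mulVec x _ = _ at this
      rw [hx] at this
      exact zero_of_add this.symm
  have hB : Fintype.card R.Face ≤ B.rank + 1 := by
    rw [← Matrix.rank_transpose]
    refine card_le_rank_add_one _ fun y hy => R.eq_of_forall_faceOf_symm hG fun d => ?_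
    have := R.faceEdgeMatrix_transpose_mulVec y d
    change B.transpose.mulVec y _ = _ at this
    rw [hy] at this
    exact zero_of_add this.symm
  -- Around a face every vertex occurs equally often as start and as end of a dart, so `B * A = 0`.
  have hle : LinearMap.range A.mulVecLin ≤ LinearMap.ker B.mulVecLin := by
    rintro _ ⟨x, rfl⟩
    rw [LinearMap.mem_ker]
    ext f
    change R.faceEdgeMatrix.mulVec ((edgeVertexMatrix G).mulVec x) f = 0
    rw [faceEdgeMatrix_mulVec]
    simp only [edgeVertexMatrix_mulVec]
    rw [sum_add_distrib, sum_face_snd, CharTwo.add_self_eq_zero]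
  have hker := B.mulVecLin.finrank_range_add_finrank_ker
  rw [Module.finrank_fintype_fun_eq_card] at hker
  change B.rank + _ = _ at hker
  rw [Nat.card_eq_fintype_card, Nat.card_eq_fintype_card, Nat.card_eq_fintype_card] at hE
  -- By Euler's formula, `dim ker B = |E| - rank B ≤ |E| - |F| + 1 = |V| - 1 ≤ rank A`.
  have heq := Submodule.eq_of_le_of_finrank_le hle (by
    change _ ≤ A.rank
    omega)
  have hmem : (fun e : G.edgeSet => c e) ∈ LinearMap.ker B.mulVecLin := by
    rw [LinearMap.mem_ker]
    ext f
    change R.faceEdgeMatrix.mulVec _ f = 0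
    rw [faceEdgeMatrix_mulVec]
    exact hc f
  rw [← heq] at hmem
  obtain ⟨x, hx⟩ := hmem
  refine ⟨x, fun d => ?_⟩
  rw [← edgeVertexMatrix_mulVec]
  exact congrFun hx _

/-! ### Colouring the triangulation and its Kleetope -/

/-- The vertices of a planar triangulation have a 2-colouring without monochromatic faces. -/
lemma IsPlanarTriangulation.exists_coloring [Finite V] {R : G.RotationSystem}
    (hR : R.IsPlanarTriangulation) :
    ∃ x : V → Fin 2, ∀ f, ∃ u v, R.OnFace u f ∧ R.OnFace v f ∧ x u ≠ x v := by
  classical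
  have := Fintype.ofFinite G.Dart
  obtain ⟨hP, h3⟩ := hR
  obtain ⟨m, hm⟩ := R.exists_edgeSet_existsUnique_dart h3
  have hcard (f) : #{d | R.faceOf d = f ∧ d.edge ∉ m} = 2 := by
    have h1 : #{d | R.faceOf d = f ∧ d.edge ∈ m} = 1 := by
      obtain ⟨d, hd, hu⟩ := hm f
      refine card_eq_one.2 ⟨d, ?_⟩
      ext e
      simp only [mem_filter, mem_univ, true_and, mem_singleton]
      exact ⟨hu e, fun h => h ▸ hd⟩
    have h2 := R.card_face h3 f
    rw [← card_filter_add_card_filter_not (fun d : G.Dart => d.edge ∈ m), filter_filter,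
      filter_filter, h1] at h2
    omega
  obtain ⟨x, hx⟩ := R.exists_eq_add_of_sum_face_eq_zero hP (fun e => if e ∉ m then 1 else 0) (by
    intro f
    rw [← sum_filter, filter_filter, sum_const, hcard]
    decide)
  -- `ZMod 2` unfolds to `Fin 2`.
  refine ⟨x, fun f => ?_⟩
  obtain ⟨d, hd⟩ : ({d | R.faceOf d = f ∧ d.edge ∉ m} : Finset G.Dart).Nonempty := by
    rw [← card_pos, hcard]
    norm_num
  obtain ⟨-, rfl, hdm⟩ := mem_filter.1 hd
  refine ⟨d.fst, d.snd, R.onFace_fst d, R.onFace_snd d, fun h => ?_⟩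
  have := hx d
  rw [if_pos hdm] at this
  change x d.fst = x d.snd at h
  rw [h, CharTwo.add_self_eq_zero] at this
  exact zero_ne_one this

/-- Two distinct vertices of a triangular face are adjacent and have a common neighbour on it. -/
lemma exists_adj_adj_of_onFace [Finite V] (h3 : ∀ f, R.faceLength f = 3) {f : R.Face} {u v : V}
    (hu : R.OnFace u f) (hv : R.OnFace v f) (huv : u ≠ v) :
    G.Adj u v ∧ ∃ w, G.Adj u w ∧ G.Adj v w := by
  classical
  have := Fintype.ofFinite G.Dart
  obtain ⟨d, rfl, rfl⟩ := hu
  obtain ⟨e, he, rfl⟩ := hv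
  have hcyc : R.facePerm.IsCycleOn
      (({a | R.faceOf a = R.faceOf d} : Finset G.Dart) : Set G.Dart) := by
    refine ⟨⟨fun a ha => ?_, R.facePerm.injective.injOn, fun a ha => ?_⟩, fun a ha b hb => ?_⟩
    · simpa [faceOf_facePerm] using ha
    · refine ⟨R.facePerm.symm a, ?_, by simp⟩
      have := R.faceOf_facePerm (R.facePerm.symm a)
      rw [Equiv.apply_symm_apply] at this
      simpa [← this] using ha
    · rw [← faceOf_eq_iff]
      simp only [coe_filter, mem_univ, true_and, Set.mem_ofPred_eq] at ha hb
      rw [ha, hb]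
  have hd : d ∈ ({a | R.faceOf a = R.faceOf d} : Finset G.Dart) := by simp
  have he' : e ∈ ({a | R.faceOf a = R.faceOf d} : Finset G.Dart) := by simpa using he
  have hpow := hcyc.pow_card_apply hd
  obtain ⟨n, hn, hne⟩ := hcyc.exists_pow_eq hd he'
  rw [R.card_face h3] at hpow hn
  let φ := R.facePerm
  have h3d : φ (φ (φ d)) = d := hpow
  have hadj (a : G.Dart) : G.Adj a.fst (φ a).fst := by
    rw [R.fst_facePerm]
    exact a.adj
  have h1 := hadj d
  have h2 := hadj (φ d)
  have h0 := hadj (φ (φ d))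
  rw [h3d] at h0
  interval_cases n
  · exact absurd (congrArg (fun a : G.Dart => a.fst) hne) huv
  · obtain rfl : φ d = e := hne
    exact ⟨h1, _, h0.symm, h2⟩
  · obtain rfl : φ (φ d) = e := hne
    exact ⟨h0.symm, _, h1, h2.symm⟩

/-- Euler's formula excludes the one-vertex graph: it has no darts, hence no faces here, and `1 - 0
+ 0 ≠ 2`. -/
lemma IsPlanar.exists_dart [Finite V] {R : G.RotationSystem} (hR : R.IsPlanar) (v : V) :
    ∃ d : G.Dart, d.fst = v := by
  obtain ⟨hG, hE⟩ := hR
  rcases subsingleton_or_nontrivial V with h | h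
  · have hD : IsEmpty G.Dart := ⟨fun d => d.fst_ne_snd (Subsingleton.elim _ _)⟩
    have hF : IsEmpty R.Face := ⟨fun f => (R.faceOf_surjective f).elim fun d _ => hD.elim d⟩
    have hV : Nat.card V ≤ 1 := Finite.card_le_one_iff_subsingleton.2 h
    rw [Nat.card_of_isEmpty (α := R.Face)] at hE
    omega
  · obtain ⟨w, hw⟩ := hG.preconnected.exists_adj_of_nontrivial v
    exact ⟨⟨(v, w), hw⟩, rfl⟩

/-- The Kleetope of a planar triangulation has a 2-colouring with totally dominating classes. -/
theorem IsPlanarTriangulation.exists_kleetope_coloring [Finite V] {R : G.RotationSystem}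
    (hR : R.IsPlanarTriangulation) :
    ∃ C : V ⊕ R.Face → Fin 2, ∀ i, R.kleetope.IsTotalDominating (C ⁻¹' {i}) := by
  classical
  obtain ⟨x, hx⟩ := hR.exists_coloring
  let bad (v : V) : Prop := ∀ w, G.Adj v w → x w ≠ x v
  have hbad {f : R.Face} {u v : V} (hu : R.OnFace u f) (hv : R.OnFace v f) (bu : bad u)
      (bv : bad v) : u = v := by
    -- Otherwise `u`, `v` and a common neighbour `w` would need three distinct colours.
    by_contra huv
    obtain ⟨h, w, hw, hw'⟩ := R.exists_adj_adj_of_onFace hR.2 hu hv huv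
    have := bu _ h
    have := bu _ hw
    have := bv _ hw'
    omega
  -- The default 0 is arbitrary: without a bad vertex on `f`, no vertex relies on the colour of `f`.
  let y (f : R.Face) : Fin 2 := if h : ∃ v, R.OnFace v f ∧ bad v then x h.choose else 0
  have hy {f : R.Face} {v : V} (hv : R.OnFace v f) (bv : bad v) : y f = x v := by
    have h : ∃ v, R.OnFace v f ∧ bad v := ⟨v, hv, bv⟩
    simp only [y, dif_pos h]
    rw [hbad h.choose_spec.1 hv h.choose_spec.2 bv]
  refine ⟨Sum.elim x y, fun i => ?_⟩
  rintro (v | f)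
  · obtain ⟨d, rfl⟩ := hR.1.exists_dart v
    by_cases hi : i = x d.fst
    · subst hi
      by_cases hb : bad d.fst
      · exact ⟨Sum.inr (R.faceOf d), hy (R.onFace_fst d) hb, R.onFace_fst d⟩
      · simp only [bad, not_forall, not_not] at hb
        obtain ⟨w, hw, hw'⟩ := hb
        exact ⟨Sum.inl w, hw', hw⟩
    · obtain ⟨u, hu, hne⟩ : ∃ u, R.OnFace u (R.faceOf d) ∧ x u ≠ x d.fst := by
        obtain ⟨u, w, hu, hw, huw⟩ := hx (R.faceOf d)
        by_cases h : x u = x d.fst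
        · exact ⟨w, hw, fun h' => huw (h.trans h'.symm)⟩
        · exact ⟨u, hu, h⟩
      have hadj := (R.exists_adj_adj_of_onFace hR.2 (R.onFace_fst d) hu
        (fun h => hne (h ▸ rfl))).1
      refine ⟨Sum.inl u, ?_, hadj⟩
      change x u = i
      omega
  · obtain ⟨u, v, hu, hv, huv⟩ := hx f
    by_cases hi : x u = i
    · exact ⟨Sum.inl u, hi, hu⟩
    · refine ⟨Sum.inl v, ?_, hv⟩
      change x v = i
      omega

end RotationSystem

/-- The supremum needs a bounded set: total domination of any one vertex forces every colour to be
used, so there are at most `Nat.card V` colours. -/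
lemma le_totalDomaticNumber {V : Type*} [Finite V] [Nonempty V] {G : SimpleGraph V} {k : ℕ}
    {C : V → Fin k} (hC : ∀ i, G.IsTotalDominating (C ⁻¹' {i})) : k ≤ G.totalDomaticNumber := by
  refine le_csSup ⟨Nat.card V, ?_⟩ ⟨C, hC⟩
  rintro l ⟨D, hD⟩
  have hsurj : Function.Surjective D := fun i => by
    obtain ⟨w, hw, -⟩ := hD i (Classical.arbitrary V)
    exact ⟨w, hw⟩
  simpa using Nat.card_le_card_of_surjective D hsurj

end SimpleGraph

theorem mainTheorem9 {V : Type*} [Finite V] (G : SimpleGraph V) (R : G.RotationSystem)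
    (hR : R.IsPlanarTriangulation) :
    2 ≤ R.kleetope.totalDomaticNumber ∧
      ∃ A B : Set (V ⊕ R.Face), Disjoint A B ∧
        R.kleetope.IsTotalDominating A ∧ R.kleetope.IsTotalDominating B := by
  obtain ⟨C, hC⟩ := hR.exists_kleetope_coloring
  have := hR.1.1.nonempty
  refine ⟨SimpleGraph.le_totalDomaticNumber hC, C ⁻¹' {0}, C ⁻¹' {1}, ?_, hC 0, hC 1⟩
  exact Disjoint.preimage C (by simp)
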